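/- Let $\mathbb K$ be an arbitrary field, let $t\ge 1$ and $k\ge 3$ be integers, and put $n:=t(k-1)+2$. Let ${\rm GA}(t,k)$ be the Cayley graph of $\mathbb Z_n$ with connection set $\{1+jt \mid 0\le j\le k-1\}$ (that is, its vertex set is $\mathbb Z_n$ and its edges are the pairs $\{a,a+s\}$ with $a\in\mathbb Z_n$ and $s$ in the connection set), and let ${\rm GA}(t,k)'$ be the graph obtained from ${\rm GA}(t,k)$ by deleting all the edges $\{i,i+1\}$, $i\in\mathbb Z_n$. For a graph $G$ with vertices $x_1,\dots,x_n$, let $I(G)=\langle x_ix_j \mid \{x_i,x_j\}\in E(G)\rangle\subseteq R=\mathbb K[x_1,\dots,x_n]$ be its edge ideal. Then the projective dimension of the $R$-module $I({\rm GA}(t,k)')$ (equivalently, the length of its minimal graded free resolution) is $${\rm pd}\big(I({\rm GA}(t,k)')\big)=n-t-2=t(k-2).$$ -/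

import Mathlib

/-- The generalized Andrásfai graph `GA(t,k)`: the Cayley (circulant) graph of `ℤ/n`, with
`n = t(k-1)+2`, whose connection set is `{1 + jt | 0 ≤ j ≤ k-1}`. -/
def generalizedAndrasfai (t k : ℕ) : SimpleGraph (ZMod (t * (k - 1) + 2)) :=
  SimpleGraph.circulantGraph {a | ∃ j : ℕ, j < k ∧ a = 1 + (j : ZMod (t * (k - 1) + 2)) * t}

/-- The exterior cycle of `GA(t,k)`: its edges are the `{i, i+1}` with `i ∈ ℤ/n`. -/
def exteriorCycle (t k : ℕ) : SimpleGraph (ZMod (t * (k - 1) + 2)) :=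
  SimpleGraph.circulantGraph {1}

/-- The graph `GA(t,k)'`: the graph `GA(t,k)` with the edges of the exterior cycle deleted. -/
def generalizedAndrasfai' (t k : ℕ) : SimpleGraph (ZMod (t * (k - 1) + 2)) :=
  generalizedAndrasfai t k \ exteriorCycle t k

/-- The edge ideal of a graph `G` in the polynomial ring over `K` with one variable for each
vertex: it is generated by the products `x_u x_v` over the edges `{u, v}` of `G`. -/
noncomputable def edgeIdeal (K : Type*) [Field K] {V : Type*} (G : SimpleGraph V) : Ideal (MvPolynomial V K) :=
  Ideal.span {f | ∃ u v : V, G.Adj u v ∧ f = MvPolynomial.X u * MvPolynomial.X v}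

/-- The projective dimension of an ideal `I` of a commutative ring `R`, as an `R`-module. -/
noncomputable def Ideal.projDim {R : Type*} [CommRing R] (I : Ideal R) : WithBot ℕ∞ :=
  CategoryTheory.projectiveDimension (ModuleCat.of R I)

/-! By the syzygy shift it suffices that `R ⧸ I` has projective dimension `n - (t + 1)`. Upper
bound: write the vertices as `0, …, n - 1`. An edge joins two vertices at distance `1 + jt` with `1
≤ j ≤ k - 2`, so it spans at least `t` interior vertices, and two later neighbours of a vertex have
at least `t - 1` vertices between them. `IsSpaced` with `s = t + 1` records this. Split on the
smallest vertex `x`, by colon and by sum. Passing to the colon loses at least one variable and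
lowers `s` by at most one; adding `x` merely moves it from `W` to `D`. Hence `|W| + |D| - s` never
grows, and it bounds the projective dimension once no edges remain
(`IsSpaced.hasProjectiveDimensionLE`). Lower bound: `{0, …, t}` is a maximal independent set, so its
complement is a minimal vertex cover with `n - t - 1` elements. Inverting the variables outside the
cover turns the edge ideal into one generated by a regular sequence of that length. -/

/-! ### Projective dimension along colon sequences -/

open CategoryTheory in
/-- Multiplication by `x` induces a short exact sequence
`0 → R ⧸ (I : x) → R ⧸ I → R ⧸ (I + (x)) → 0`. -/
theorem exists_shortExact_colon {R : Type*} [CommRing R] {I J L : Ideal R} {x : R}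
    (hJ : ∀ f, x * f ∈ I ↔ f ∈ J) (hL : L = I ⊔ Ideal.span {x}) :
    ∃ S : ShortComplex (ModuleCat R), S.ShortExact ∧ S.X₁ = ModuleCat.of R (R ⧸ J) ∧
      S.X₂ = ModuleCat.of R (R ⧸ I) ∧ S.X₃ = ModuleCat.of R (R ⧸ L) := by
  have hIL : I ≤ L := hL ▸ le_sup_left
  let f : (R ⧸ J) →ₗ[R] (R ⧸ I) :=
    Submodule.mapQ J I (LinearMap.mulLeft R x) fun a ha => (hJ a).2 ha
  let g : (R ⧸ I) →ₗ[R] (R ⧸ L) := Submodule.factor hIL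
  have hf : Function.Injective f := by
    rw [← LinearMap.ker_eq_bot, LinearMap.ker_eq_bot']
    intro m hm
    obtain ⟨a, rfl⟩ := Submodule.Quotient.mk_surjective _ m
    have h : x * a ∈ I := (Submodule.Quotient.mk_eq_zero I).1 hm
    exact (Submodule.Quotient.mk_eq_zero J).2 ((hJ a).1 h)
  have hg : Function.Surjective g := Submodule.factor_surjective hIL
  have hfg : Function.Exact f g := by
    intro m
    obtain ⟨a, rfl⟩ := Submodule.Quotient.mk_surjective _ m
    constructor
    · intro h
      have h : a ∈ L := (Submodule.Quotient.mk_eq_zero L).1 h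
      rw [hL] at h
      obtain ⟨i, hi, y, hy, rfl⟩ := Submodule.mem_sup.1 h
      obtain ⟨c, rfl⟩ := Ideal.mem_span_singleton'.1 hy
      refine ⟨Submodule.Quotient.mk c, ?_⟩
      refine (Submodule.Quotient.eq I).2 ?_
      have : (LinearMap.mulLeft R x) c - (i + c * x) = -i := by simp; ring
      rw [this]
      exact I.neg_mem hi
    · rintro ⟨m, hm⟩
      obtain ⟨c, rfl⟩ := Submodule.Quotient.mk_surjective _ m
      rw [← hm]
      refine (Submodule.Quotient.mk_eq_zero L).2 ?_
      rw [hL]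
      exact Ideal.mem_sup_right (Ideal.mul_mem_right _ _ (Ideal.mem_span_singleton_self x))
  refine ⟨ShortComplex.mk (ModuleCat.ofHom f) (ModuleCat.ofHom g) ?_, ?_, rfl, rfl, rfl⟩
  · exact ModuleCat.hom_ext (LinearMap.ext fun m => hfg.apply_apply_eq_zero m)
  · exact
      { exact := (ShortComplex.ShortExact.moduleCat_exact_iff_function_exact _).2 hfg
        mono_f := (ModuleCat.mono_iff_injective _).2 hf
        epi_g := (ModuleCat.epi_iff_surjective _).2 hg }

open CategoryTheory in
theorem hasProjectiveDimensionLE_quotient_of_colon {R : Type*} [CommRing R] {I J L : Ideal R}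
    {x : R} (hJ : ∀ f, x * f ∈ I ↔ f ∈ J) (hL : L = I ⊔ Ideal.span {x}) {n : ℕ}
    (h₁ : HasProjectiveDimensionLE (ModuleCat.of R (R ⧸ J)) n)
    (h₃ : HasProjectiveDimensionLE (ModuleCat.of R (R ⧸ L)) n) :
    HasProjectiveDimensionLE (ModuleCat.of R (R ⧸ I)) n := by
  obtain ⟨S, hS, e₁, e₂, e₃⟩ := exists_shortExact_colon hJ hL
  rw [← e₂]
  exact hS.hasProjectiveDimensionLT_X₂ _ (e₁ ▸ h₁) (e₃ ▸ h₃)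

open CategoryTheory in
theorem hasProjectiveDimensionLE_quotient_sup_span {R : Type*} [CommRing R] {I L : Ideal R}
    {x : R} (hx : ∀ f, x * f ∈ I ↔ f ∈ I) (hL : L = I ⊔ Ideal.span {x}) {n : ℕ}
    (h : HasProjectiveDimensionLE (ModuleCat.of R (R ⧸ I)) n) :
    HasProjectiveDimensionLE (ModuleCat.of R (R ⧸ L)) (n + 1) := by
  obtain ⟨S, hS, e₁, e₂, e₃⟩ := exists_shortExact_colon hx hL
  rw [← e₃]
  exact hS.hasProjectiveDimensionLT_X₃ _ (e₁ ▸ h)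
    (e₂ ▸ hasProjectiveDimensionLT_of_ge _ (n + 1) (n + 1 + 1) (by omega))

open CategoryTheory in
/-- The syzygy shift between an ideal and its residue class ring. -/
theorem hasProjectiveDimensionLT_ideal_iff {R : Type*} [CommRing R] (I : Ideal R) (n : ℕ) :
    HasProjectiveDimensionLT (ModuleCat.of R I) (n + 1) ↔
      HasProjectiveDimensionLT (ModuleCat.of R (R ⧸ I)) (n + 2) := by
  have hIL : Function.Exact I.subtype (Submodule.mkQ I) := LinearMap.exact_subtype_mkQ I
  let S : ShortComplex (ModuleCat R) := ShortComplex.mk (ModuleCat.ofHom I.subtype)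
    (ModuleCat.ofHom (Submodule.mkQ I)) 
    (ModuleCat.hom_ext (LinearMap.ext fun m => hIL.apply_apply_eq_zero m))
  have hS : S.ShortExact :=
    { exact := (ShortComplex.ShortExact.moduleCat_exact_iff_function_exact _).2 hIL
      mono_f := (ModuleCat.mono_iff_injective _).2 I.injective_subtype
      epi_g := (ModuleCat.epi_iff_surjective _).2 (Submodule.mkQ_surjective I) }
  have : Projective (ModuleCat.of R R) := ModuleCat.projective_of_free (Module.Basis.singleton Unit R)
  exact (hS.hasProjectiveDimensionLT_X₃_iff n this).symm

/-! ### Edge ideals with added variables -/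

/-- The ideal generated by the edges of `G` inside `W` and the variables in `D`. -/
noncomputable def edgeVarIdeal (K : Type*) [Field K] {V : Type*} (G : SimpleGraph V)
    (W D : Finset V) : Ideal (MvPolynomial V K) :=
  Ideal.span ((fun s => MvPolynomial.monomial s (1 : K)) ''
    ({s | ∃ u ∈ W, ∃ v ∈ W, G.Adj u v ∧ s = Finsupp.single u 1 + Finsupp.single v 1} ∪
      {s | ∃ v ∈ D, s = Finsupp.single v 1}))

section edgeVarIdeal

variable {K : Type*} [Field K] {V : Type*} {G : SimpleGraph V} {W D : Finset V}

theorem mem_edgeVarIdeal {f : MvPolynomial V K} :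
    f ∈ edgeVarIdeal K G W D ↔ ∀ m ∈ f.support,
      (∃ u ∈ W, ∃ v ∈ W, G.Adj u v ∧ m u ≠ 0 ∧ m v ≠ 0) ∨ ∃ v ∈ D, m v ≠ 0 := by
  classical
  rw [edgeVarIdeal, MvPolynomial.mem_ideal_span_monomial_image]
  refine forall₂_congr fun m _ => ?_
  constructor
  · rintro ⟨s, ⟨u, hu, v, hv, huv, rfl⟩ | ⟨v, hv, rfl⟩, hs⟩
    · refine Or.inl ⟨u, hu, v, hv, huv, ?_, ?_⟩
      · have := hs u
        simp only [Finsupp.add_apply, Finsupp.single_apply] at this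
        simp at this
        omega
      · have := hs v
        simp only [Finsupp.add_apply, Finsupp.single_apply] at this
        simp at this
        omega
    · refine Or.inr ⟨v, hv, ?_⟩
      have := hs v
      simp at this
      omega
  · rintro (⟨u, hu, v, hv, huv, hmu, hmv⟩ | ⟨v, hv, hm⟩)
    · refine ⟨_, Or.inl ⟨u, hu, v, hv, huv, rfl⟩, fun w => ?_⟩
      have := huv.ne
      simp only [Finsupp.add_apply, Finsupp.single_apply]
      split_ifs <;> subst_vars <;> first | omega | exact absurd rfl this
    · refine ⟨_, Or.inr ⟨v, hv, rfl⟩, fun w => ?_⟩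
      simp only [Finsupp.single_apply]
      split_ifs <;> subst_vars <;> omega

/-- In the colon by `x` each neighbour of `x` becomes a generator and absorbs its own edges; only
edges among the non-neighbours survive. -/
theorem X_mul_mem_edgeVarIdeal [DecidableEq V] [DecidableRel G.Adj] {x : V} (hx : x ∈ W)
    (hxD : x ∉ D) (f : MvPolynomial V K) :
    MvPolynomial.X x * f ∈ edgeVarIdeal K G W D ↔
      f ∈ edgeVarIdeal K G (W.filter fun w => w ≠ x ∧ ¬ G.Adj x w)
        (D ∪ W.filter fun w => G.Adj x w) := by
  rw [mem_edgeVarIdeal, mem_edgeVarIdeal, MvPolynomial.support_X_mul]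
  simp only [Finset.mem_map, forall_exists_index, and_imp, forall_apply_eq_imp_iff₂,
    addLeftEmbedding_apply]
  refine forall₂_congr fun m _ => ?_
  simp only [Finsupp.add_apply, Finsupp.single_apply, Finset.mem_filter, Finset.mem_union]
  constructor
  · rintro (⟨u, hu, v, hv, huv, hmu, hmv⟩ | ⟨v, hv, hm⟩)
    · by_cases h₁ : G.Adj x u ∧ m u ≠ 0
      · exact Or.inr ⟨u, Or.inr ⟨hu, h₁.1⟩, h₁.2⟩
      by_cases h₂ : G.Adj x v ∧ m v ≠ 0
      · exact Or.inr ⟨v, Or.inr ⟨hv, h₂.1⟩, h₂.2⟩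
      have hux : x ≠ u := by
        rintro rfl
        rw [if_neg huv.ne] at hmv
        exact h₂ ⟨huv, by omega⟩
      have hvx : x ≠ v := by
        rintro rfl
        rw [if_neg huv.ne'] at hmu
        exact h₁ ⟨huv.symm, by omega⟩
      rw [if_neg hux] at hmu
      rw [if_neg hvx] at hmv
      refine Or.inl ⟨u, ⟨hu, hux.symm, fun h => h₁ ⟨h, by omega⟩⟩, v,
        ⟨hv, hvx.symm, fun h => h₂ ⟨h, by omega⟩⟩, huv, by omega, by omega⟩
    · have : x ≠ v := fun h => hxD (h ▸ hv)
      rw [if_neg this] at hm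
      exact Or.inr ⟨v, Or.inl hv, by omega⟩
  · rintro (⟨u, ⟨hu, -⟩, v, ⟨hv, -⟩, huv, hmu, hmv⟩ | ⟨v, hv | ⟨hv, hxv⟩, hm⟩)
    · exact Or.inl ⟨u, hu, v, hv, huv, by omega, by omega⟩
    · exact Or.inr ⟨v, hv, by omega⟩
    · exact Or.inl ⟨x, hx, v, hv, hxv, by simp, by omega⟩

theorem edgeVarIdeal_erase_insert [DecidableEq V] {x : V} :
    edgeVarIdeal K G (W.erase x) (insert x D) =
      edgeVarIdeal K G W D ⊔ Ideal.span {MvPolynomial.X x} := by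
  have hX : (MvPolynomial.X x : MvPolynomial V K) ∈ edgeVarIdeal K G (W.erase x) (insert x D) :=
    Ideal.subset_span ⟨Finsupp.single x 1, Or.inr ⟨x, Finset.mem_insert_self _ _, rfl⟩, rfl⟩
  apply le_antisymm
  · refine Ideal.span_le.2 ?_
    rintro _ ⟨s, ⟨u, hu, v, hv, huv, rfl⟩ | ⟨v, hv, rfl⟩, rfl⟩
    · exact Ideal.mem_sup_left (Ideal.subset_span ⟨_, Or.inl ⟨u, Finset.mem_of_mem_erase hu, v,
        Finset.mem_of_mem_erase hv, huv, rfl⟩, rfl⟩)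
    · obtain rfl | hv := Finset.mem_insert.1 hv
      · exact Ideal.mem_sup_right (Ideal.mem_span_singleton_self _)
      · exact Ideal.mem_sup_left (Ideal.subset_span ⟨_, Or.inr ⟨v, hv, rfl⟩, rfl⟩)
  · refine sup_le (fun f hf => ?_) (Ideal.span_le.2 (Set.singleton_subset_iff.2 hX))
    rw [mem_edgeVarIdeal] at hf ⊢
    intro m hm
    by_cases hmx : m x = 0
    · obtain ⟨u, hu, v, hv, huv, hmu, hmv⟩ | ⟨v, hv, hmv⟩ := hf m hm
      · exact Or.inl ⟨u, Finset.mem_erase.2 ⟨fun h => hmu (h ▸ hmx), hu⟩, v,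
          Finset.mem_erase.2 ⟨fun h => hmv (h ▸ hmx), hv⟩, huv, hmu, hmv⟩
      · exact Or.inr ⟨v, Finset.mem_insert_of_mem hv, hmv⟩
    · exact Or.inr ⟨x, Finset.mem_insert_self _ _, hmx⟩

theorem edgeVarIdeal_eq_of_not_adj {W' : Finset V} (h : ∀ u ∈ W, ∀ v ∈ W, ¬ G.Adj u v)
    (h' : ∀ u ∈ W', ∀ v ∈ W', ¬ G.Adj u v) :
    edgeVarIdeal K G W D = edgeVarIdeal K G W' D := by
  ext f
  simp only [mem_edgeVarIdeal]
  grind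

theorem edgeVarIdeal_univ_empty [Fintype V] :
    edgeVarIdeal K G Finset.univ ∅ = edgeIdeal K G := by
  rw [edgeVarIdeal, edgeIdeal]
  congr 1
  ext f
  simp [MvPolynomial.X, MvPolynomial.monomial_mul, eq_comm]

open CategoryTheory in
/-- A quotient by variables is resolved by their Koszul complex. -/
theorem hasProjectiveDimensionLE_edgeVarIdeal_of_not_adj
    (h : ∀ u ∈ W, ∀ v ∈ W, ¬ G.Adj u v) :
    HasProjectiveDimensionLE
      (ModuleCat.of (MvPolynomial V K) (MvPolynomial V K ⧸ edgeVarIdeal K G W D)) D.card := by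
  classical
  rw [edgeVarIdeal_eq_of_not_adj (W' := ∅) h (by simp)]
  induction D using Finset.induction_on with
  | empty =>
    have hb : edgeVarIdeal K G ∅ ∅ = (⊥ : Ideal (MvPolynomial V K)) := by simp [edgeVarIdeal]
    rw [hb]
    have : Module.Free (MvPolynomial V K) (MvPolynomial V K ⧸ (⊥ : Ideal (MvPolynomial V K))) :=
      Module.Free.of_equiv (Submodule.quotEquivOfEqBot ⊥ rfl).symm
    have : Projective (ModuleCat.of (MvPolynomial V K)
        (MvPolynomial V K ⧸ (⊥ : Ideal (MvPolynomial V K)))) :=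
      ModuleCat.projective_of_categoryTheory_projective _
    exact (projective_iff_hasProjectiveDimensionLE_zero _).1 this
  | insert x D hx ih =>
    rw [Finset.card_insert_of_notMem hx]
    -- The colon lemma needs its variable in `W`; a lone vertex carries no edge, so `{x}` may
    -- replace `∅`.
    have e : edgeVarIdeal K G {x} D = edgeVarIdeal K G ∅ D :=
      edgeVarIdeal_eq_of_not_adj (by simp) (by simp)
    refine hasProjectiveDimensionLE_quotient_sup_span (I := edgeVarIdeal K G ∅ D)
      (x := MvPolynomial.X x) (fun f => ?_) ?_ ih
    · have := X_mul_mem_edgeVarIdeal (K := K) (G := G) (Finset.mem_singleton_self x) hx f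
      rw [e] at this
      rw [this]
      have h₁ : ({x} : Finset V).filter (fun w => w ≠ x ∧ ¬ G.Adj x w) = ∅ := by grind
      have h₂ : ({x} : Finset V).filter (fun w => G.Adj x w) = ∅ := by
        ext; simp; rintro rfl; simp
      rw [h₁, h₂, Finset.union_empty]
    · rw [← e, ← edgeVarIdeal_erase_insert]
      simp

end edgeVarIdeal

/-! ### Spaced vertex sets and the upper bound -/

/-- The elements of `W` strictly between `u` and `v`. -/
def between {V : Type*} [LinearOrder V] (W : Finset V) (u v : V) : Finset V :=
  W.filter fun w => u < w ∧ w < v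

/-- Edges of `G` inside `W` are long, later neighbours of a vertex are far apart, and `W` is
large, as measured by `s`. -/
structure IsSpaced {V : Type*} [LinearOrder V] (G : SimpleGraph V) (W : Finset V) (s : ℕ) :
    Prop where
  adj : ∀ u ∈ W, ∀ v ∈ W, u < v → G.Adj u v → s ≤ (between W u v).card + 1
  nbr : ∀ u ∈ W, ∀ v ∈ W, ∀ w ∈ W, u < v → v < w → G.Adj u v → G.Adj u w →
    s ≤ (between W v w).card + 2
  card : s ≤ W.card

namespace IsSpaced

variable {V : Type*} [LinearOrder V] {G : SimpleGraph V} {W : Finset V} {s : ℕ}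

theorem erase (h : IsSpaced G W s) {x : V} (hx : x ∈ W) (hmin : ∀ w ∈ W, x ≤ w)
    (hs : s < W.card) : IsSpaced G (W.erase x) s := by
  have hb : ∀ u ∈ W, ∀ v, between (W.erase x) u v = between W u v := by
    intro u hu v
    ext w
    simp only [between, Finset.mem_filter, Finset.mem_erase]
    have := hmin u hu
    constructor
    · rintro ⟨⟨-, h₁⟩, h₂⟩
      exact ⟨h₁, h₂⟩
    · rintro ⟨h₁, h₂⟩
      exact ⟨⟨(this.trans_lt h₂.1).ne', h₁⟩, h₂⟩
  refine ⟨fun u hu v hv => ?_, fun u hu v hv w hw => ?_, ?_⟩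
  · rw [hb u (Finset.mem_of_mem_erase hu)]
    exact h.adj u (Finset.mem_of_mem_erase hu) v (Finset.mem_of_mem_erase hv)
  · rw [hb v (Finset.mem_of_mem_erase hv)]
    exact h.nbr u (Finset.mem_of_mem_erase hu) v (Finset.mem_of_mem_erase hv) w
      (Finset.mem_of_mem_erase hw)
  · rw [Finset.card_erase_of_mem hx]
    omega

/-- If the interval contains two neighbours of `x`, the first two, `p < q`, have only non-neighbours
between them; these survive, and `nbr` makes them numerous. -/
theorem card_between_filter [DecidableRel G.Adj] (h : IsSpaced G W s) {x : V} (hx : x ∈ W)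
    {u : V} (hxu : x < u) (v : V) :
    (between W u v).card ≤
        (between (W.filter fun w => w ≠ x ∧ ¬ G.Adj x w) u v).card + 1 ∨
      s ≤ (between (W.filter fun w => w ≠ x ∧ ¬ G.Adj x w) u v).card + 2 := by
  set A := between W u v
  set N := A.filter fun w => G.Adj x w
  have hA : between (W.filter fun w => w ≠ x ∧ ¬ G.Adj x w) u v =
      A.filter fun w => ¬ G.Adj x w := by
    ext w
    simp only [A, between, Finset.mem_filter]
    constructor
    · rintro ⟨⟨h₁, h₂, h₃⟩, h₄⟩
      exact ⟨⟨h₁, h₄⟩, h₃⟩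
    · rintro ⟨⟨h₁, h₂⟩, h₃⟩
      exact ⟨⟨h₁, (hxu.trans h₂.1).ne', h₃⟩, h₂⟩
  rw [hA]
  have hcard := Finset.card_filter_add_card_filter_not (s := A) (fun w => G.Adj x w)
  change N.card + _ = _ at hcard
  by_cases hN : N.card ≤ 1
  · left; omega
  right
  push Not at hN
  have hne : N.Nonempty := Finset.card_pos.1 (by omega)
  set p := N.min' hne
  have hp : p ∈ N := N.min'_mem hne
  have hne' : (N.erase p).Nonempty := Finset.card_pos.1 (by
    rw [Finset.card_erase_of_mem hp]; omega)
  set q := (N.erase p).min' hne'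
  have hq : q ∈ N.erase p := (N.erase p).min'_mem hne'
  have hqN := Finset.mem_of_mem_erase hq
  have hpq : p < q := lt_of_le_of_ne (N.min'_le q hqN) (Finset.ne_of_mem_erase hq).symm
  have hpA : p ∈ A := (Finset.mem_filter.1 hp).1
  have hqA : q ∈ A := (Finset.mem_filter.1 hqN).1
  obtain ⟨hpW, hup, hpv⟩ := Finset.mem_filter.1 hpA
  obtain ⟨hqW, huq, hqv⟩ := Finset.mem_filter.1 hqA
  refine (h.nbr x hx p hpW q hqW (hxu.trans hup) hpq (Finset.mem_filter.1 hp).2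
    (Finset.mem_filter.1 hqN).2).trans ?_
  gcongr
  intro w hw
  obtain ⟨hwW, hpw, hwq⟩ := Finset.mem_filter.1 hw
  have hwA : w ∈ A := Finset.mem_filter.2 ⟨hwW, hup.trans hpw, hwq.trans hqv⟩
  refine Finset.mem_filter.2 ⟨hwA, fun hxw => ?_⟩
  exact absurd ((N.erase p).min'_le w (Finset.mem_erase.2 ⟨hpw.ne', Finset.mem_filter.2
    ⟨hwA, hxw⟩⟩)) (not_le.2 hwq)

theorem filter [DecidableRel G.Adj] (h : IsSpaced G W s) {x : V} (hx : x ∈ W)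
    (hmin : ∀ w ∈ W, x ≤ w) :
    IsSpaced G (W.filter fun w => w ≠ x ∧ ¬ G.Adj x w) (s - 1) := by
  have hlt : ∀ u ∈ W.filter (fun w => w ≠ x ∧ ¬ G.Adj x w), u ∈ W ∧ x < u := fun u hu => by
    obtain ⟨h₁, h₂, -⟩ := Finset.mem_filter.1 hu
    exact ⟨h₁, lt_of_le_of_ne (hmin u h₁) h₂.symm⟩
  refine ⟨fun u hu v hv huv ha => ?_, fun u hu v hv w hw huv hvw ha ha' => ?_, ?_⟩
  · have h₁ := h.adj u (hlt u hu).1 v (hlt v hv).1 huv ha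
    have h₂ := h.card_between_filter hx (hlt u hu).2 v
    omega
  · have h₁ := h.nbr u (hlt u hu).1 v (hlt v hv).1 w (hlt w hw).1 huv hvw ha ha'
    have h₂ := h.card_between_filter hx (hlt v hv).2 w
    omega
  -- If `x` has a nearest neighbour `q`, the vertices between them all survive, at least `s - 1` by
  -- `adj`; otherwise only `x` is lost.
  · set N := W.filter fun w => G.Adj x w
    by_cases hN : N.Nonempty
    · set q := N.min' hN
      obtain ⟨hqW, hxq⟩ := Finset.mem_filter.1 (N.min'_mem hN)
      have hq : x < q := lt_of_le_of_ne (hmin q hqW) hxq.ne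
      have h₁ := h.adj x hx q hqW hq hxq
      have h₂ : between W x q ⊆ W.filter fun w => w ≠ x ∧ ¬ G.Adj x w := by
        intro w hw
        obtain ⟨hwW, hxw, hwq⟩ := Finset.mem_filter.1 hw
        exact Finset.mem_filter.2 ⟨hwW, hxw.ne', fun hA =>
          absurd (N.min'_le w (Finset.mem_filter.2 ⟨hwW, hA⟩)) (not_le.2 hwq)⟩
      have := Finset.card_le_card h₂
      omega
    · have h₂ : W.erase x ⊆ W.filter fun w => w ≠ x ∧ ¬ G.Adj x w := by
        intro w hw
        obtain ⟨hwx, hwW⟩ := Finset.mem_erase.1 hw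
        exact Finset.mem_filter.2 ⟨hwW, hwx, fun hA => hN ⟨w, Finset.mem_filter.2 ⟨hwW, hA⟩⟩⟩
      have := Finset.card_le_card h₂
      rw [Finset.card_erase_of_mem hx] at this
      have := h.card
      omega

/-- An edge would need `s - 1` interior vertices besides its two ends. -/
theorem not_adj (h : IsSpaced G W s) (hs : W.card ≤ s) : ∀ u ∈ W, ∀ v ∈ W, ¬ G.Adj u v := by
  have key : ∀ u ∈ W, ∀ v ∈ W, u < v → ¬ G.Adj u v := by
    intro u hu v hv huv ha
    have h₁ := h.adj u hu v hv huv ha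
    have h₂ : between W u v ⊆ (W.erase u).erase v := by
      intro w hw
      obtain ⟨hwW, huw, hwv⟩ := Finset.mem_filter.1 hw
      exact Finset.mem_erase.2 ⟨hwv.ne, Finset.mem_erase.2 ⟨huw.ne', hwW⟩⟩
    have h₃ := Finset.card_le_card h₂
    rw [Finset.card_erase_of_mem (Finset.mem_erase.2 ⟨huv.ne', hv⟩),
      Finset.card_erase_of_mem hu] at h₃
    have := Finset.card_pos.2 ⟨u, hu⟩
    have : 1 < W.card := Finset.one_lt_card.2 ⟨u, hu, v, hv, huv.ne⟩
    omega
  intro u hu v hv ha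
  obtain huv | huv := lt_or_gt_of_ne ha.ne
  · exact key u hu v hv huv ha
  · exact key v hv u hu huv ha.symm

-- Induction on `|W|`, splitting on its minimum until `|W| = s`, when no edge is left and `|D| ≤ m`.
open CategoryTheory in
theorem hasProjectiveDimensionLE {K : Type*} [Field K] {D : Finset V} (h : IsSpaced G W s)
    (hD : Disjoint W D) {m : ℕ} (hm : W.card + D.card ≤ m + s) :
    HasProjectiveDimensionLE
      (ModuleCat.of (MvPolynomial V K) (MvPolynomial V K ⧸ edgeVarIdeal K G W D)) m := by
  classical
  induction hc : W.card using Nat.strong_induction_on generalizing W D s m with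
  | _ c ih =>
  subst hc
  by_cases hs : W.card ≤ s
  · have hDm : D.card ≤ m := by have := h.card; omega
    have := hasProjectiveDimensionLE_edgeVarIdeal_of_not_adj (K := K) (D := D) (h.not_adj hs)
    exact hasProjectiveDimensionLT_of_ge _ (D.card + 1) (m + 1) (by omega)
  push Not at hs
  have hne : W.Nonempty := Finset.card_pos.1 (by omega)
  obtain ⟨x, hx, hmin⟩ : ∃ x ∈ W, ∀ w ∈ W, x ≤ w :=
    ⟨W.min' hne, W.min'_mem hne, fun w hw => W.min'_le w hw⟩
  have hxD : x ∉ D := Finset.disjoint_left.1 hD hx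
  refine hasProjectiveDimensionLE_quotient_of_colon
    (fun f => X_mul_mem_edgeVarIdeal (K := K) (G := G) hx hxD f) edgeVarIdeal_erase_insert ?_ ?_
  · have hsub : W.filter (fun w => w ≠ x ∧ ¬ G.Adj x w) ⊆ W.erase x := by
      intro w hw
      obtain ⟨h₁, h₂, -⟩ := Finset.mem_filter.1 hw
      exact Finset.mem_erase.2 ⟨h₂, h₁⟩
    have hlt := Finset.card_le_card hsub
    rw [Finset.card_erase_of_mem hx] at hlt
    have hcard : (W.filter fun w => w ≠ x ∧ ¬ G.Adj x w).card +
        (W.filter fun w => G.Adj x w).card ≤ W.card - 1 := by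
      rw [← Finset.card_erase_of_mem hx, ← Finset.card_union_of_disjoint]
      · refine Finset.card_le_card (Finset.union_subset hsub fun w hw => ?_)
        obtain ⟨h₁, h₂⟩ := Finset.mem_filter.1 hw
        exact Finset.mem_erase.2 ⟨h₂.ne', h₁⟩
      · refine Finset.disjoint_left.2 fun w hw hw' => ?_
        exact (Finset.mem_filter.1 hw).2.2 (Finset.mem_filter.1 hw').2
    have hu := Finset.card_union_le D (W.filter fun w => G.Adj x w)
    refine ih _ (by omega) (h.filter hx hmin) ?_ (by omega) rfl
    refine Finset.disjoint_left.2 fun w hw hw' => ?_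
    obtain ⟨h₁, -, h₂⟩ := Finset.mem_filter.1 hw
    obtain h₃ | h₃ := Finset.mem_union.1 hw'
    · exact Finset.disjoint_left.1 hD h₁ h₃
    · exact h₂ (Finset.mem_filter.1 h₃).2
  · have hlt := Finset.card_erase_of_mem hx
    refine ih _ (by omega) (h.erase hx hmin hs) ?_ ?_ rfl
    · refine Finset.disjoint_left.2 fun w hw hw' => ?_
      obtain ⟨h₁, h₂⟩ := Finset.mem_erase.1 hw
      obtain h₃ | h₃ := Finset.mem_insert.1 hw'
      · exact h₁ h₃
      · exact Finset.disjoint_left.1 hD h₂ h₃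
    · rw [Finset.card_insert_of_notMem hxD]
      omega

end IsSpaced

/-! ### Lower bound by localization at a minimal vertex cover -/

open MvPolynomial RingTheory.Sequence in
/-- Distinct variables form a weakly regular sequence. -/
theorem isWeaklyRegular_map_X {K : Type*} [Field K] {V : Type*} {l : List V} (hl : l.Nodup) :
    IsWeaklyRegular (MvPolynomial V K) (l.map fun v => (X v : MvPolynomial V K)) := by
  classical
  rw [isWeaklyRegular_iff]
  intro i hi
  rw [List.length_map] at hi
  have hspan : Ideal.ofList ((l.map fun v => (X v : MvPolynomial V K)).take i) •
      (⊤ : Submodule (MvPolynomial V K) (MvPolynomial V K)) =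
      Ideal.span (X '' {v | v ∈ l.take i}) := by
    rw [smul_eq_mul, Ideal.mul_top, Ideal.ofList, ← List.map_take]
    congr 1
    ext f
    exact List.mem_map
  rw [hspan, List.getElem_map, isSMulRegular_iff_right_eq_zero_of_smul]
  intro m hm
  obtain ⟨f, rfl⟩ := Submodule.Quotient.mk_surjective _ m
  rw [← Submodule.Quotient.mk_smul, Submodule.Quotient.mk_eq_zero, smul_eq_mul,
    mem_ideal_span_X_image] at hm
  rw [Submodule.Quotient.mk_eq_zero, mem_ideal_span_X_image]
  intro m hmf
  obtain ⟨v, hv, hmv⟩ := hm (Finsupp.single l[i] 1 + m) (by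
    rw [support_X_mul]
    exact Finset.mem_map.2 ⟨m, hmf, rfl⟩)
  refine ⟨v, hv, ?_⟩
  have hne : l[i] ≠ v := by
    rintro rfl
    obtain ⟨j, hj, e⟩ := List.mem_take_iff_getElem.1 hv
    have := (List.Nodup.getElem_inj_iff hl).1 e
    omega
  simpa [Finsupp.single_apply, hne] using hmv

open CategoryTheory RingTheory.Sequence in
/-- If `I` becomes generated by a regular sequence in the localization at `P`, then the length
of the sequence bounds the projective dimension of `R ⧸ I` from below. -/
theorem length_le_projectiveDimension_quotient {R : Type*} [CommRing R] [IsNoetherianRing R]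
    (I P : Ideal R) [P.IsPrime] {l : List R} (hl : IsWeaklyRegular R l) (hP : ∀ r ∈ l, r ∈ P)
    (hI : I.map (algebraMap R (Localization.AtPrime P)) =
      Ideal.ofList (l.map (algebraMap R (Localization.AtPrime P)))) :
    (l.length : WithBot ℕ∞) ≤ projectiveDimension (ModuleCat.of R (R ⧸ I)) := by
  let S := Localization.AtPrime P
  have hreg : IsRegular S (l.map (algebraMap R S)) :=
    hl.isRegular_of_isLocalization_of_mem S P hP
  have : IsNoetherianRing S := IsLocalization.isNoetherianRing P.primeCompl S inferInstance
  have hdim := ModuleCat.projectiveDimension_quotient_eq_length _ hreg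
  rw [List.length_map] at hdim
  -- Localizing cannot raise projective dimension, and over the local ring the value for a regular
  -- sequence is exact.
  refine le_trans ?_ (ModuleCat.projectiveDimension_le_projectiveDimension_of_isLocalizedModule
    P.primeCompl (ModuleCat.of R (R ⧸ I)))
  rw [← hdim]
  have hloc : Submodule.localized' S P.primeCompl (Algebra.linearMap R S) I =
      Ideal.ofList (l.map (algebraMap R S)) := by
    rw [← hI]; exact Ideal.localized'_eq_map S P.primeCompl _
  let e₁ : LocalizedModule P.primeCompl (R ⧸ I) ≃ₗ[S]
      S ⧸ Submodule.localized' S P.primeCompl (Algebra.linearMap R S) I :=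
    LinearEquiv.extendScalarsOfIsLocalization P.primeCompl S
      (IsLocalizedModule.linearEquiv P.primeCompl
        (LocalizedModule.mkLinearMap P.primeCompl (R ⧸ I))
        (Submodule.toLocalizedQuotient' S P.primeCompl (Algebra.linearMap R S) I))
  have e₂ := (Shrink.linearEquiv S (S ⧸ Ideal.ofList (l.map (algebraMap R S)))).trans
    ((Submodule.quotEquivOfEq _ _ hloc.symm).trans e₁.symm)
  have : Small (LocalizedModule P.primeCompl (R ⧸ I)) := inferInstance
  have e₃ := e₂.trans (Shrink.linearEquiv S _).symm
  exact (projectiveDimension_eq_of_iso e₃.toModuleIso).le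

open MvPolynomial in
theorem exists_isPrime_X_mem_iff (K : Type*) [Field K] {V : Type*} (C : Set V) :
    ∃ P : Ideal (MvPolynomial V K), P.IsPrime ∧ ∀ v, X v ∈ P ↔ v ∈ C := by
  classical
  -- The kernel of evaluation at a 0/1 point is prime because the target is a field.
  refine ⟨RingHom.ker (eval fun v => if v ∈ C then (0 : K) else 1), RingHom.ker_isPrime _,
    fun v => ?_⟩
  rw [RingHom.mem_ker, eval_X]
  simp

-- Covering puts every edge in the ideal of `C`; conversely, each `c` in `C` has a neighbour outside
-- `C`, whose variable is a unit.
open MvPolynomial in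
theorem map_edgeIdeal_eq_ofList {K : Type*} [Field K] {V : Type*} (G : SimpleGraph V)
    (C : Finset V) (hC : ∀ u v, G.Adj u v → u ∈ C ∨ v ∈ C)
    (hmin : ∀ c ∈ C, ∃ a, a ∉ C ∧ G.Adj a c) {S : Type*} [CommRing S]
    (φ : MvPolynomial V K →+* S) (hφ : ∀ a, a ∉ C → IsUnit (φ (X a))) :
    (edgeIdeal K G).map φ = Ideal.ofList ((C.toList.map fun v => X v).map φ) := by
  apply le_antisymm
  · rw [edgeIdeal, Ideal.map_span, Ideal.span_le]
    have hc : ∀ c ∈ C, φ (X c) ∈ Ideal.ofList ((C.toList.map fun v => X v).map φ) :=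
      fun c hc => Ideal.subset_span
        (List.mem_map_of_mem (List.mem_map_of_mem (Finset.mem_toList.2 hc)))
    rintro _ ⟨_, ⟨u, v, huv, rfl⟩, rfl⟩
    rw [SetLike.mem_coe, map_mul]
    obtain hu | hv := hC u v huv
    · exact Ideal.mul_mem_right _ _ (hc u hu)
    · exact Ideal.mul_mem_left _ _ (hc v hv)
  · rw [Ideal.ofList, Ideal.span_le]
    intro f hf
    obtain ⟨r, hr, rfl⟩ := List.mem_map.1 hf
    obtain ⟨c, hc, rfl⟩ := List.mem_map.1 hr
    obtain ⟨a, ha, hac⟩ := hmin c (Finset.mem_toList.1 hc)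
    refine (Ideal.unit_mul_mem_iff_mem _ (hφ a ha)).1 ?_
    rw [← map_mul]
    exact Ideal.mem_map_of_mem _ (Ideal.subset_span ⟨a, c, hac, rfl⟩)

open CategoryTheory MvPolynomial in
/-- The projective dimension of `R ⧸ I(G)` is at least the size of any minimal vertex cover. -/
theorem card_le_projectiveDimension_of_minimal_cover {K : Type*} [Field K] {V : Type*} [Finite V]
    (G : SimpleGraph V) (C : Finset V) (hC : ∀ u v, G.Adj u v → u ∈ C ∨ v ∈ C)
    (hmin : ∀ c ∈ C, ∃ a, a ∉ C ∧ G.Adj a c) :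
    (C.card : WithBot ℕ∞) ≤ projectiveDimension
      (ModuleCat.of (MvPolynomial V K) (MvPolynomial V K ⧸ edgeIdeal K G)) := by
  obtain ⟨P, hP, hX⟩ := exists_isPrime_X_mem_iff K (C : Set V)
  have h := length_le_projectiveDimension_quotient (edgeIdeal K G) P
    (isWeaklyRegular_map_X C.nodup_toList) (fun r hr => ?_)
    (map_edgeIdeal_eq_ofList G C hC hmin _ fun a ha =>
      IsLocalization.map_units _ (⟨X a, fun h => ha ((hX a).1 h)⟩ : P.primeCompl))
  · rwa [List.length_map, Finset.length_toList] at h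
  · obtain ⟨v, hv, rfl⟩ := List.mem_map.1 hr
    exact (hX v).2 (Finset.mem_toList.1 hv)

/-! ### Arithmetic of `GA(t,k)'` -/

theorem exists_eq_one_add_natCast_mul_iff {t k : ℕ} (d : ZMod (t * (k - 1) + 2)) :
    (∃ j : ℕ, j < k ∧ d = 1 + (j : ZMod (t * (k - 1) + 2)) * t) ↔
      ∃ j, j < k ∧ d.val = 1 + j * t := by
  refine exists_congr fun j => and_congr_right fun hj => ?_
  have hlt : 1 + j * t < t * (k - 1) + 2 := by
    have := Nat.mul_le_mul_right t (show j ≤ k - 1 by omega)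
    rw [mul_comm t]
    omega
  rw [← (ZMod.val_injective _).eq_iff]
  have : (1 + (j : ZMod (t * (k - 1) + 2)) * t) =
      ((1 + j * t : ℕ) : ZMod (t * (k - 1) + 2)) := by push_cast; rfl
  rw [this, ZMod.val_natCast_of_lt hlt]

/-- Adjacency in `GA(t,k)'` in terms of the representatives in `{0, …, n - 1}`. -/
theorem generalizedAndrasfai'_adj_iff {t k : ℕ} (ht : 1 ≤ t) (hk : 3 ≤ k)
    (u v : ZMod (t * (k - 1) + 2)) :
    (generalizedAndrasfai' t k).Adj u v ↔ ∃ j, 1 ≤ j ∧ j ≤ k - 2 ∧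
      (u.val = v.val + (1 + j * t) ∨ v.val = u.val + (1 + j * t)) := by
  wlog huv : v.val ≤ u.val generalizing u v
  · rw [SimpleGraph.adj_comm, this v u (by omega)]
    simp only [or_comm]
  obtain rfl | hne := eq_or_ne u v
  · simp
  have hlt : v.val < u.val := lt_of_le_of_ne huv fun h => hne (ZMod.val_injective _ h.symm)
  have hu := ZMod.val_lt u
  have hd : (u - v).val = u.val - v.val := ZMod.val_sub huv
  have hd' : (v - u).val = t * (k - 1) + 2 - (u.val - v.val) := by
    have : NeZero (u - v) := ⟨sub_ne_zero.2 hne⟩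
    rw [← neg_sub u v, ZMod.val_neg_of_ne_zero, hd]
  have h1 : ∀ w : ZMod (t * (k - 1) + 2), w = 1 ↔ w.val = 1 := fun w => by
    rw [← (ZMod.val_injective _).eq_iff, ZMod.val_one_eq_one_mod, Nat.mod_eq_of_lt (by omega)]
  simp only [generalizedAndrasfai', generalizedAndrasfai, exteriorCycle, SimpleGraph.sdiff_adj,
    SimpleGraph.circulantGraph, SimpleGraph.fromRel_adj, Set.mem_ofPred_eq, Set.mem_singleton_iff,
    exists_eq_one_add_natCast_mul_iff, h1, hd, hd', ne_eq, hne, not_false_eq_true, true_and]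
  -- Reversing an edge swaps `j` with `k - 1 - j`, since `n - (1 + jt) = 1 + (k - 1 - j)t`. The
  -- exterior cycle is the pair `j = 0`, `j = k - 1`.
  have hsym : ∀ j, j ≤ k - 1 → t * (k - 1) = j * t + (k - 1 - j) * t := fun j hj => by
    rw [← Nat.add_mul, Nat.add_sub_cancel' hj, mul_comm]
  constructor
  · rintro ⟨⟨j, hj, h⟩ | ⟨j, hj, h⟩, hn⟩
    · have hs := hsym j (by omega)
      have h0 : j ≠ 0 := by rintro rfl; omega
      have h0' : k - 1 - j ≠ 0 := fun h0 => by rw [h0] at hs; omega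
      exact ⟨j, by omega, by omega, Or.inl (by omega)⟩
    · have hs := hsym j (by omega)
      have h0 : j ≠ 0 := by rintro rfl; omega
      have h0' : k - 1 - j ≠ 0 := fun h0 => by rw [h0] at hs; omega
      exact ⟨k - 1 - j, by omega, by omega, Or.inl (by omega)⟩
  · rintro ⟨j, hj, hj', h⟩
    have hs := hsym j (by omega)
    have p₁ := Nat.mul_le_mul_right t hj
    have p₂ := Nat.mul_le_mul_right t (show 1 ≤ k - 1 - j by omega)
    exact ⟨Or.inl ⟨j, by omega, by omega⟩, by omega⟩

/-- The order on `ℤ/n` by representatives in `{0, …, n - 1}`. -/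
abbrev zmodLinearOrder (n : ℕ) [NeZero n] : LinearOrder (ZMod n) :=
  LinearOrder.lift' ZMod.val (ZMod.val_injective n)

theorem card_filter_val_lt {n : ℕ} [NeZero n] {a b : ℕ} (hb : b ≤ n) :
    (Finset.univ.filter fun w : ZMod n => a < w.val ∧ w.val < b).card = b - a - 1 := by
  rw [← Nat.card_Ioo]
  refine Finset.card_nbij ZMod.val ?_ (ZMod.val_injective n).injOn ?_
  · intro w hw
    simpa using hw
  · intro m hm
    simp only [Finset.coe_Ioo, Set.mem_Ioo] at hm
    refine ⟨(m : ZMod n), ?_, ZMod.val_natCast_of_lt (by omega)⟩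
    simp [ZMod.val_natCast_of_lt (show m < n by omega), hm]

theorem isSpaced_generalizedAndrasfai' {t k : ℕ} (ht : 1 ≤ t) (hk : 3 ≤ k) :
    letI := zmodLinearOrder (t * (k - 1) + 2)
    IsSpaced (generalizedAndrasfai' t k) Finset.univ (t + 1) := by
  let := zmodLinearOrder (t * (k - 1) + 2)
  have hlt : ∀ u v : ZMod (t * (k - 1) + 2), u < v ↔ u.val < v.val := fun u v => Iff.rfl
  have hb : ∀ u v : ZMod (t * (k - 1) + 2),
      (between Finset.univ u v).card = v.val - u.val - 1 := fun u v =>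
    card_filter_val_lt (ZMod.val_lt v).le
  refine ⟨fun u _ v _ huv ha => ?_, fun u _ v _ w _ huv hvw ha ha' => ?_, ?_⟩
  · rw [generalizedAndrasfai'_adj_iff ht hk] at ha
    rw [hlt] at huv
    obtain ⟨j, hj, -, h⟩ := ha
    rw [hb]
    have := Nat.mul_le_mul_right t hj
    omega
  · rw [generalizedAndrasfai'_adj_iff ht hk] at ha ha'
    rw [hlt] at huv hvw
    obtain ⟨i, hi, -, h⟩ := ha
    obtain ⟨j, hj, -, h'⟩ := ha'
    rw [hb]
    -- Distances from `u` to its later neighbours differ by a positive multiple of `t`.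
    have hij : i < j := lt_of_not_ge fun hji => by
      have := Nat.mul_le_mul_right t hji
      omega
    have := Nat.mul_le_mul_right t (Nat.succ_le_of_lt hij)
    rw [Nat.succ_mul] at this
    omega
  · rw [Finset.card_univ, ZMod.card]
    have : t * 2 ≤ t * (k - 1) := Nat.mul_le_mul_left t (by omega)
    omega

/-- Write `c = r + 1 + qt` with `r < t`: the neighbour is `r`, except for `c = n - 1`, where `q = k
- 1` is too large and the neighbour is `t`. -/
theorem exists_adj_of_lt_val {t k : ℕ} (ht : 1 ≤ t) (hk : 3 ≤ k) {c : ZMod (t * (k - 1) + 2)}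
    (hc : t < c.val) : ∃ a : ZMod (t * (k - 1) + 2), a.val ≤ t ∧
      (generalizedAndrasfai' t k).Adj a c := by
  have hlt := ZMod.val_lt c
  obtain ⟨m, rfl⟩ := Nat.exists_eq_add_of_le hk
  replace hlt : c.val < t * (m + 2) + 2 := by
    rwa [← show 3 + m - 1 = m + 2 by omega]
  have e := Nat.div_add_mod (c.val - 1) t
  have hr := Nat.mod_lt (c.val - 1) (show 0 < t by omega)
  generalize (c.val - 1) / t = q at e
  generalize (c.val - 1) % t = r at e hr
  have hq : 1 ≤ q := by
    by_contra h
    have : q = 0 := by omega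
    rw [this] at e
    omega
  have hq' : q ≤ m + 2 := by
    by_contra h
    have := Nat.mul_le_mul_left t (show m + 3 ≤ q by omega)
    rw [Nat.mul_succ t (m + 2)] at this
    omega
  have key : ∀ j a, 1 ≤ j → j ≤ m + 1 → a ≤ t → c.val = a + (1 + j * t) →
      ∃ a : ZMod (t * (3 + m - 1) + 2), a.val ≤ t ∧
        (generalizedAndrasfai' t (3 + m)).Adj a c := by
    intro j a hj hj' ha h
    have hv : ((a : ℕ) : ZMod (t * (3 + m - 1) + 2)).val = a :=
      ZMod.val_natCast_of_lt ((by omega : a < c.val).trans (ZMod.val_lt c))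
    refine ⟨(a : ZMod _), by rwa [hv], ?_⟩
    rw [generalizedAndrasfai'_adj_iff ht hk]
    exact ⟨j, hj, by omega, Or.inr (by rw [hv, h])⟩
  obtain hq'' | hq'' := Nat.lt_or_ge q (m + 2)
  · exact key q r hq (by omega) hr.le (by rw [mul_comm q]; omega)
  · have hqe : q = m + 2 := by omega
    rw [hqe] at e
    refine key (m + 1) t (by omega) le_rfl le_rfl ?_
    have : t * (m + 2) = t + (m + 1) * t := by ring
    omega

theorem val_gt_of_adj {t k : ℕ} (ht : 1 ≤ t) (hk : 3 ≤ k) {u v : ZMod (t * (k - 1) + 2)}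
    (h : (generalizedAndrasfai' t k).Adj u v) : t < u.val ∨ t < v.val := by
  rw [generalizedAndrasfai'_adj_iff ht hk] at h
  obtain ⟨j, hj, -, h⟩ := h
  have := Nat.mul_le_mul_right t hj
  omega

/-! ### The projective dimension -/

open CategoryTheory in
theorem mainTheorem2 (K : Type*) [Field K] (t k n : ℕ) (ht : 1 ≤ t) (hk : 3 ≤ k)
    (hn : n = t * (k - 1) + 2) :
    (edgeIdeal K (generalizedAndrasfai' t k)).projDim = ((n - t - 2 : ℕ) : WithBot ℕ∞) ∧
      n - t - 2 = t * (k - 2) := by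
  have hnt : n - t - 2 = t * (k - 2) := by
    rw [hn, show k - 1 = k - 2 + 1 by omega, Nat.mul_succ]
    omega
  have hpos : 1 ≤ n - t - 2 := hnt ▸ Nat.mul_pos ht (by omega)
  refine ⟨?_, hnt⟩
  -- The syzygy shift needs a positive index, so the value is written `d + 1`; the quotient then has
  -- value `d + 2 = n - (t + 1)`.
  obtain ⟨d, hd⟩ : ∃ d, n - t - 2 = d + 1 := ⟨n - t - 2 - 1, by omega⟩
  rw [hd, Ideal.projDim]
  apply le_antisymm
  · rw [projectiveDimension_le_iff]
    let := zmodLinearOrder (t * (k - 1) + 2)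
    have h := (isSpaced_generalizedAndrasfai' ht hk).hasProjectiveDimensionLE (K := K)
      (D := ∅) (m := d + 2) (Finset.disjoint_empty_right _) (by
        rw [Finset.card_univ, ZMod.card, Finset.card_empty]; omega)
    rw [edgeVarIdeal_univ_empty] at h
    exact (hasProjectiveDimensionLT_ideal_iff _ (d + 1)).2 h
  · rw [projectiveDimension_ge_iff, hasProjectiveDimensionLT_ideal_iff,
      ← projectiveDimension_ge_iff]
    have h := card_le_projectiveDimension_of_minimal_cover (K := K) (generalizedAndrasfai' t k)
      -- The second inequality always holds; it puts the cover in the form `card_filter_val_lt`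
      -- counts.
      (Finset.univ.filter fun w => t < w.val ∧ w.val < t * (k - 1) + 2)
      (fun u v huv => by
        simpa [ZMod.val_lt] using val_gt_of_adj ht hk huv)
      (fun c hc => by
        obtain ⟨a, ha, hac⟩ := exists_adj_of_lt_val ht hk (Finset.mem_filter.1 hc).2.1
        exact ⟨a, by simp [ha], hac⟩)
    rw [card_filter_val_lt le_rfl] at h
    rwa [show t * (k - 1) + 2 - t - 1 = d + 2 by omega] at h
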